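/- Let $d\ge 1$, let $L(\mathbb C^d)$ be the algebra of linear operators on $\mathbb C^d$, and let $I$ be its identity map. A state is a positive semidefinite operator of trace $1$. A meter with finite outcome set $X$ is a map $M:X\to L(\mathbb C^d)$ with $M(x)\ge 0$ and $\sum_x M(x)=\mathbb 1$. A meter $\mathsf Q$ with outcomes $\{0,\dots,d-1\}$ is sharp if $\mathsf Q(x)=|\varphi_x\rangle\langle\varphi_x|$ for an orthonormal basis $(\varphi_x)$ of $\mathbb C^d$. A channel is a completely positive linear map $\Phi$ between operator algebras with $\mathrm{tr}\,\Phi(\rho)=1$ for every state $\rho$; an instrument is a family $\mathcal J(x,\cdot)$ of completely positive linear maps, $x\in X$, whose sum is a channel. The adjoint of $\Phi$ is given by $\mathrm{tr}(\rho\,\Phi^\dagger(A))=\mathrm{tr}(\Phi(\rho)A)$. For $s,t\in[0,1]$ put $$\mathsf Q_s(x)=s\,\mathsf Q(x)+(1-s)\tfrac1d\mathbb 1,\qquad I_t(\rho)=t\rho+(1-t)\,\mathrm{tr}(\rho)\tfrac1d\mathbb 1 .$$ Let $CR(I,I)$ be the set of $(s,t)\in[0,1]^2$ for which there is a channel $\Gamma:L(\mathbb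 C^d)\to L(\mathbb C^d\otimes\mathbb C^d)$ such that the partial trace of $\Gamma$ over the second factor is $I_s$ and the one over the first factor is $I_t$. Let $CR(\mathsf Q,I)$ be the set of $(s,t)\in[0,1]^2$ for which there is an instrument $\mathcal J$ on $L(\mathbb C^d)$ with outcomes $\{0,\dots,d-1\}$ such that $\mathcal J^\dagger(x,\mathbb 1)=\mathsf Q_s(x)$ for all $x$ and $\sum_x\mathcal J(x,\cdot)=I_t$. A joint meter for $\mathsf Q_s$ and $\mathsf P_t$ is a meter $\mathsf G(x,y)$ with $\sum_y\mathsf G(x,y)=\mathsf Q_s(x)$ and $\sum_x\mathsf G(x,y)=\mathsf P_t(y)$; an approximate joint meter of $\mathsf Q$ and $\mathsf P$ is a joint meter for $\mathsf Q_s$ and $\mathsf P_t$ for some $s,t\in[0,1]$. A universal cloner is a channel $\Gamma:L(\mathbb C^d)\to L(\mathbb C^d\otimes\mathbb C^d)$ such that, for all sharp meters $\mathsf Q',\mathsf P'$, $\mathsf G^\Gamma_{\mathsf Q',\mathsf P'}(x,y)=\Gamma^\dagger(\mathsf Q'(x)\otimes\mathsf P'(y))$ is an approximate joint meter of $\mathsf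 Q'$ and $\mathsf P'$. A sequential scheme with $\mathsf Q$ fixed is an instrument $\mathcal J$ on $L(\mathbb C^d)$ with outcomes $\{0,\dots,d-1\}$ such that, for every sharp meter $\mathsf P'$, $\mathsf G^{\mathcal J}_{\mathsf P'}(x,y)=\mathcal J^\dagger(x,\mathsf P'(y))$ is an approximate joint meter of $\mathsf Q$ and $\mathsf P'$. (In both definitions the noise parameters may depend on the meters.) **Theorem.** For every sharp meter $\mathsf Q$ on $\mathbb C^d$, $$CR(\mathsf Q,I)=CR(I,I).$$ Moreover, for every sharp meter $\mathsf P$, the set of $(s,t)\in[0,1]^2$ such that $\mathsf G^\Gamma_{\mathsf Q,\mathsf P}$ is a joint meter for $\mathsf Q_s$ and $\mathsf P_t$ for some universal cloner $\Gamma$, and the set of $(s,t)\in[0,1]^2$ such that $\mathsf G^{\mathcal J}_{\mathsf P}$ is a joint meter for $\mathsf Q_s$ and $\mathsf P_t$ for some sequential scheme $\mathcal J$ with $\mathsf Q$ fixed, are equal, and both are equal to $CR(I,I)$. That is, when $\mathsf P$ is arbitrary, knowing $\mathsf Q$ in advance gives no advantage over universal cloning. -/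

import Mathlib

/-! Finite-dimensional quantum devices: meters, channels, instruments, and their compatibility.
Operators on `ℂⁿ` are matrices in the standard basis; `ℂ^d ⊗ ℂ^d` is indexed by pairs. -/

namespace Qudit

open scoped Kronecker ComplexOrder

/-- Linear operators on `ℂⁿ`, written as matrices in the standard basis. -/
abbrev Op (n : Type) : Type := Matrix n n ℂ

/-- A state: a positive semidefinite operator of trace one. -/
def IsState {n : Type} [Fintype n] (ρ : Op n) : Prop :=
  ρ.PosSemidef ∧ ρ.trace = 1

/-- A meter (positive operator valued measure) with the finite outcome set `X`. -/
def IsMeter {X n : Type} [Fintype X] [Fintype n] [DecidableEq n] (M : X → Op n) : Prop :=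
  (∀ x, (M x).PosSemidef) ∧ ∑ x, M x = 1

section CompletelyPositive

open scoped MatrixOrder Matrix.Norms.L2Operator CStarAlgebra

/-- Complete positivity of a linear map between matrix algebras, regarded as C⋆-algebras. -/
def IsCP {m n : Type} [Fintype m] [DecidableEq m] [Fintype n] [DecidableEq n]
    (Φ : Op m →ₗ[ℂ] Op n) : Prop :=
  ∃ f : Op m →CP Op n, f.toLinearMap = Φ

theorem cstar_nonneg_iff {B : Type} [NonUnitalCStarAlgebra B] [PartialOrder B]
    [StarOrderedRing B] (a : B) : 0 ≤ a ↔ ∃ x, a = star x * x :=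
  CStarAlgebra.nonneg_iff_eq_star_mul_self

theorem cstarMatrix_nonneg_iff {n : Type} [Fintype n] [DecidableEq n] (k : ℕ)
    (A : CStarMatrix (Fin k) (Fin k) (Op n)) :
    0 ≤ A ↔ (Matrix.comp (Fin k) (Fin k) n n ℂ (CStarMatrix.ofMatrix.symm A)).PosSemidef := by
  have key : ∀ B : CStarMatrix (Fin k) (Fin k) (Op n),
      Matrix.comp (Fin k) (Fin k) n n ℂ (CStarMatrix.ofMatrix.symm (star B * B)) =
      (Matrix.comp (Fin k) (Fin k) n n ℂ (CStarMatrix.ofMatrix.symm B)).conjTranspose *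
      Matrix.comp (Fin k) (Fin k) n n ℂ (CStarMatrix.ofMatrix.symm B) := by
    intro B
    ext ⟨i, a⟩ ⟨j, b⟩
    have h : (star B * B) i j = ∑ l, (B l i).conjTranspose * B l j := by
      rw [CStarMatrix.mul_apply]
      rfl
    change ((star B * B) i j) a b = _
    rw [h, Matrix.sum_apply, Matrix.mul_apply, Fintype.sum_prod_type]
    rfl
  refine (cstar_nonneg_iff A).trans ?_
  constructor
  · rintro ⟨B, rfl⟩
    rw [key]
    exact Matrix.posSemidef_conjTranspose_mul_self _
  · intro h
    obtain ⟨B, hB⟩ := CStarAlgebra.nonneg_iff_eq_star_mul_self.mp h.nonneg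
    refine ⟨CStarMatrix.ofMatrix ((Matrix.comp (Fin k) (Fin k) n n ℂ).symm B), ?_⟩
    apply CStarMatrix.ofMatrix.symm.injective
    apply (Matrix.comp (Fin k) (Fin k) n n ℂ).injective
    rw [key, hB]
    simp [Matrix.star_eq_conjTranspose]


/-- Complete positivity in terms of block matrices: every `id_k ⊗ Φ` preserves positive
semidefiniteness. -/
theorem isCP_iff {m n : Type} [Fintype m] [DecidableEq m] [Fintype n] [DecidableEq n]
    (Φ : Op m →ₗ[ℂ] Op n) :
    IsCP Φ ↔ ∀ (k : ℕ) (A : Matrix (Fin k) (Fin k) (Op m)),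
      (Matrix.comp (Fin k) (Fin k) m m ℂ A).PosSemidef →
      (Matrix.comp (Fin k) (Fin k) n n ℂ (A.map Φ)).PosSemidef := by
  constructor
  · rintro ⟨f, rfl⟩ k A hA
    have := f.map_cstarMatrix_nonneg' k (CStarMatrix.ofMatrix A)
      ((cstarMatrix_nonneg_iff k _).2 hA)
    exact (cstarMatrix_nonneg_iff k _).1 this
  · intro h
    exact ⟨{ toLinearMap := Φ
             map_cstarMatrix_nonneg' := fun k M hM =>
               (cstarMatrix_nonneg_iff k _).2 (h k _ ((cstarMatrix_nonneg_iff k _).1 hM)) }, rfl⟩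

end CompletelyPositive

/-- A channel: a completely positive linear map sending states to operators of trace one. -/
def IsChannel {m n : Type} [Fintype m] [DecidableEq m] [Fintype n] [DecidableEq n]
    (Φ : Op m →ₗ[ℂ] Op n) : Prop :=
  IsCP Φ ∧ ∀ ρ : Op m, IsState ρ → (Φ ρ).trace = 1

/-- An instrument with outcome set `X`: completely positive maps adding up to a channel. -/
def IsInstrument {X m n : Type} [Fintype X] [Fintype m] [DecidableEq m] [Fintype n]
    [DecidableEq n] (J : X → Op m →ₗ[ℂ] Op n) : Prop :=
  (∀ x, IsCP (J x)) ∧ IsChannel (∑ x, J x)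

/-- The adjoint (Heisenberg picture) of `Φ`, characterized by
`tr (ρ * adjointMap Φ A) = tr (Φ ρ * A)`. -/
def adjointMap {m n : Type} [Fintype m] [DecidableEq m] [Fintype n]
    (Φ : Op m →ₗ[ℂ] Op n) : Op n →ₗ[ℂ] Op m where
  toFun A := Matrix.of fun i j => (Φ (Matrix.single j i 1) * A).trace
  map_add' A B := by
    ext i j
    simp [Matrix.mul_add]
  map_smul' c A := by
    ext i j
    simp

theorem trace_mul_adjointMap {m n : Type} [Fintype m] [DecidableEq m] [Fintype n]
    (Φ : Op m →ₗ[ℂ] Op n) (ρ : Op m) (A : Op n) :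
    (ρ * adjointMap Φ A).trace = (Φ ρ * A).trace := by
  have h : Φ ρ = ∑ i, ∑ j, ρ i j • Φ (Matrix.single i j 1) := by
    conv_lhs => rw [Matrix.matrix_eq_sum_single ρ]
    rw [map_sum]
    refine Finset.sum_congr rfl fun i _ => ?_
    rw [map_sum]
    refine Finset.sum_congr rfl fun j _ => ?_
    rw [← map_smul, Matrix.smul_single, smul_eq_mul, mul_one]
  rw [h]
  simp only [Finset.sum_mul, Matrix.trace_sum, Matrix.smul_mul, Matrix.trace_smul, smul_eq_mul]
  simp only [Matrix.trace, Matrix.diag_apply, Matrix.mul_apply (M := ρ)]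
  rfl

/-- The first clone: the partial trace over the second tensor factor. -/
def firstClone (n : Type) [Fintype n] : Op (n × n) →ₗ[ℂ] Op n where
  toFun R := Matrix.of fun i j => ∑ k, R (i, k) (j, k)
  map_add' A B := by
    ext i j
    simp [Finset.sum_add_distrib]
  map_smul' c A := by
    ext i j
    simp [Finset.mul_sum]

/-- The second clone: the partial trace over the first tensor factor. -/
def secondClone (n : Type) [Fintype n] : Op (n × n) →ₗ[ℂ] Op n where
  toFun R := Matrix.of fun i j => ∑ k, R (k, i) (k, j)
  map_add' A B := by
    ext i j
    simp [Finset.sum_add_distrib]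
  map_smul' c A := by
    ext i j
    simp [Finset.mul_sum]

/-- A sharp meter: the rank-one projections `|φ_x⟩⟨φ_x|` onto an orthonormal basis of `ℂ^d`. -/
def IsSharpMeter {d : ℕ} (Q : Fin d → Op (Fin d)) : Prop :=
  ∃ φ : OrthonormalBasis (Fin d) ℂ (EuclideanSpace ℂ (Fin d)),
    ∀ x, Q x = Matrix.of fun i j => φ x i * star (φ x j)

/-- The noisy version `M_s(x) = s M(x) + (1 - s) 1 / d` of a meter. -/
noncomputable def noisyMeter {d : ℕ} (s : ℝ) (M : Fin d → Op (Fin d)) : Fin d → Op (Fin d) :=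
  fun x => (s : ℂ) • M x + ((1 - s : ℂ) / (d : ℂ)) • (1 : Op (Fin d))

/-- The depolarizing channel `I_r(ρ) = r ρ + (1 - r) tr(ρ) 1 / d`. -/
noncomputable def depolarizing (d : ℕ) (r : ℝ) : Op (Fin d) →ₗ[ℂ] Op (Fin d) :=
  (r : ℂ) • LinearMap.id +
    ((1 - r : ℂ) / (d : ℂ)) • (Matrix.traceLinearMap (Fin d) ℂ ℂ).smulRight (1 : Op (Fin d))

/-- `G` is a joint meter for `M` and `N`. -/
def IsJointMeter {X Y n : Type} [Fintype X] [Fintype Y] [Fintype n] [DecidableEq n]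
    (G : X × Y → Op n) (M : X → Op n) (N : Y → Op n) : Prop :=
  IsMeter G ∧ (∀ x, ∑ y, G (x, y) = M x) ∧ ∀ y, ∑ x, G (x, y) = N y

/-- `G` is an approximate joint meter of `Q` and `P`: a joint meter for some noisy versions. -/
def IsApproxJointMeter {d : ℕ} (G : Fin d × Fin d → Op (Fin d)) (Q P : Fin d → Op (Fin d)) :
    Prop :=
  ∃ s ∈ Set.Icc (0 : ℝ) 1, ∃ t ∈ Set.Icc (0 : ℝ) 1,
    IsJointMeter G (noisyMeter s Q) (noisyMeter t P)

/-- `Γ` is a joint channel for `Φ₁` and `Φ₂`. -/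
def IsJointChannel {m n : Type} [Fintype m] [DecidableEq m] [Fintype n] [DecidableEq n]
    (Γ : Op m →ₗ[ℂ] Op (n × n)) (Φ₁ Φ₂ : Op m →ₗ[ℂ] Op n) : Prop :=
  IsChannel Γ ∧ firstClone n ∘ₗ Γ = Φ₁ ∧ secondClone n ∘ₗ Γ = Φ₂

/-- `J` is a joint instrument for the meter `M` and the channel `Φ`. -/
def IsJointInstrument {X m n : Type} [Fintype X] [Fintype m] [DecidableEq m] [Fintype n]
    [DecidableEq n] (J : X → Op m →ₗ[ℂ] Op n) (M : X → Op m) (Φ : Op m →ₗ[ℂ] Op n) : Prop :=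
  IsInstrument J ∧ (∀ x, adjointMap (J x) 1 = M x) ∧ ∑ x, J x = Φ

/-- The compatibility region `CR(I, I)` in dimension `d`. -/
def regionII (d : ℕ) : Set (ℝ × ℝ) :=
  {p | p.1 ∈ Set.Icc 0 1 ∧ p.2 ∈ Set.Icc 0 1 ∧
    ∃ Γ : Op (Fin d) →ₗ[ℂ] Op (Fin d × Fin d),
      IsJointChannel Γ (depolarizing d p.1) (depolarizing d p.2)}

/-- The compatibility region `CR(Q, I)`. -/
def regionQI {d : ℕ} (Q : Fin d → Op (Fin d)) : Set (ℝ × ℝ) :=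
  {p | p.1 ∈ Set.Icc 0 1 ∧ p.2 ∈ Set.Icc 0 1 ∧
    ∃ J : Fin d → Op (Fin d) →ₗ[ℂ] Op (Fin d),
      IsJointInstrument J (noisyMeter p.1 Q) (depolarizing d p.2)}

/-- Measuring `M` on the first and `N` on the second clone produced by `Γ`. -/
def cloningMeter {d : ℕ} (Γ : Op (Fin d) →ₗ[ℂ] Op (Fin d × Fin d))
    (M N : Fin d → Op (Fin d)) : Fin d × Fin d → Op (Fin d) :=
  fun z => adjointMap Γ (M z.1 ⊗ₖ N z.2)

/-- Measuring `N` after the instrument `J`. -/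
def sequentialMeter {d : ℕ} (J : Fin d → Op (Fin d) →ₗ[ℂ] Op (Fin d))
    (N : Fin d → Op (Fin d)) : Fin d × Fin d → Op (Fin d) :=
  fun z => adjointMap (J z.1) (N z.2)

/-- A universal cloning device: a channel giving an approximate joint meter of every pair of
sharp meters. -/
def IsUniversalCloner {d : ℕ} (Γ : Op (Fin d) →ₗ[ℂ] Op (Fin d × Fin d)) : Prop :=
  IsChannel Γ ∧ ∀ Q P : Fin d → Op (Fin d), IsSharpMeter Q → IsSharpMeter P →
    IsApproxJointMeter (cloningMeter Γ Q P) Q P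

/-- A sequential scheme with `Q` fixed and the second meter free: an instrument giving an
approximate joint meter of `Q` and every sharp meter `P`. -/
def IsSequentialScheme {d : ℕ} (Q : Fin d → Op (Fin d))
    (J : Fin d → Op (Fin d) →ₗ[ℂ] Op (Fin d)) : Prop :=
  IsInstrument J ∧ ∀ P : Fin d → Op (Fin d), IsSharpMeter P →
    IsApproxJointMeter (sequentialMeter J P) Q P

/-- The noise parameters achievable for the pair `(Q, P)` by universal cloning devices. -/
def cloningTradeoff {d : ℕ} (Q P : Fin d → Op (Fin d)) : Set (ℝ × ℝ) :=
  {p | p.1 ∈ Set.Icc 0 1 ∧ p.2 ∈ Set.Icc 0 1 ∧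
    ∃ Γ : Op (Fin d) →ₗ[ℂ] Op (Fin d × Fin d), IsUniversalCloner Γ ∧
      IsJointMeter (cloningMeter Γ Q P) (noisyMeter p.1 Q) (noisyMeter p.2 P)}

/-- The noise parameters achievable for the pair `(Q, P)` by sequential schemes with `Q` fixed
and the second meter free. -/
def sequentialTradeoff {d : ℕ} (Q P : Fin d → Op (Fin d)) : Set (ℝ × ℝ) :=
  {p | p.1 ∈ Set.Icc 0 1 ∧ p.2 ∈ Set.Icc 0 1 ∧
    ∃ J : Fin d → Op (Fin d) →ₗ[ℂ] Op (Fin d), IsSequentialScheme Q J ∧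
      IsJointMeter (sequentialMeter J P) (noisyMeter p.1 Q) (noisyMeter p.2 P)}

end Qudit

/-! The proof closes the circle `regionII` ⊆ `cloningTradeoff` ⊆ `sequentialTradeoff` ⊆ `regionQI` ⊆
`regionII`; `regionII` ⊆ `regionQI` is also proved directly, by measuring the first clone.

The first two inclusions are soft. A joint channel of two depolarizing channels treats all sharp
meters alike, so it is a universal cloner; and cloning, then measuring Q on the first clone, is a
sequential scheme.

The third is a rigidity statement, `eq_depolarizing_of_noisy`. The noise on the second meter is
allowed to depend on that meter, but a linear map that only adds white noise to each sharp meter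
must add the same amount to all, so the total channel of a sequential scheme is depolarizing.

The fourth is quantitative. For d ≥ 2 both regions are cut out of the unit square by s + t ≤ 1 +
2√(1-s)√(1-t)/d. Points satisfying it are realized by cloners built from a + bS, with S the swap
(`mem_regionII_of_le`). Conversely, complete positivity tested on the maximally entangled vector
bounds the coherences an instrument can preserve once its outcomes reveal the basis
(`add_le_of_mem_regionQI`). -/

namespace Qudit

open scoped Kronecker ComplexOrder

/-! ### Completely positive maps and adjoints -/

section CPMaps
variable {l m n : Type} [Fintype l] [DecidableEq l] [Fintype m] [DecidableEq m] [Fintype n]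
  [DecidableEq n]

theorem IsCP.comp {Φ : Op m →ₗ[ℂ] Op n} {Ψ : Op l →ₗ[ℂ] Op m} (hΦ : IsCP Φ) (hΨ : IsCP Ψ) :
    IsCP (Φ ∘ₗ Ψ) := by
  rw [isCP_iff] at *
  intro k A hA
  exact hΦ k _ (hΨ k A hA)

theorem IsCP.add {Φ Ψ : Op m →ₗ[ℂ] Op n} (hΦ : IsCP Φ) (hΨ : IsCP Ψ) : IsCP (Φ + Ψ) := by
  rw [isCP_iff] at *
  intro k A hA
  exact (hΦ k A hA).add (hΨ k A hA)

theorem IsCP.zero : IsCP (0 : Op m →ₗ[ℂ] Op n) := by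
  rw [isCP_iff]
  intro k A hA
  exact Matrix.PosSemidef.zero

theorem IsCP.smul {Φ : Op m →ₗ[ℂ] Op n} (hΦ : IsCP Φ) {c : ℝ} (hc : 0 ≤ c) :
    IsCP ((c : ℂ) • Φ) := by
  rw [isCP_iff] at *
  intro k A hA
  exact (hΦ k A hA).smul (a := (c : ℂ)) (by exact_mod_cast hc)

theorem IsCP.sum {ι : Type} (s : Finset ι) {Φ : ι → Op m →ₗ[ℂ] Op n} (h : ∀ i, IsCP (Φ i)) :
    IsCP (∑ i ∈ s, Φ i) := by
  classical
  induction s using Finset.induction_on with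
  | empty => simpa using IsCP.zero
  | insert a s ha ih => rw [Finset.sum_insert ha]; exact (h a).add ih

/-- The map `ρ ↦ K ρ K†`. -/
def conjMap (K : Matrix n m ℂ) : Op m →ₗ[ℂ] Op n where
  toFun ρ := K * ρ * K.conjTranspose
  map_add' A B := by simp [Matrix.mul_add, Matrix.add_mul]
  map_smul' c A := by simp

omit [DecidableEq m] [Fintype n] [DecidableEq n] in
theorem conjMap_apply (K : Matrix n m ℂ) (ρ : Op m) :
    conjMap K ρ = K * ρ * K.conjTranspose := rfl

theorem isCP_conjMap (K : Matrix n m ℂ) : IsCP (conjMap K) := by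
  rw [isCP_iff]
  intro k A hA
  have h : Matrix.comp (Fin k) (Fin k) n n ℂ (A.map (conjMap K)) =
      ((1 : Matrix (Fin k) (Fin k) ℂ) ⊗ₖ K) * Matrix.comp (Fin k) (Fin k) m m ℂ A *
        ((1 : Matrix (Fin k) (Fin k) ℂ) ⊗ₖ K).conjTranspose := by
    ext ⟨i, a⟩ ⟨j, b⟩
    simp [Matrix.comp_apply, conjMap_apply, Matrix.mul_apply, Fintype.sum_prod_type,
      Matrix.one_apply, apply_ite, ite_mul]
  rw [h]
  exact hA.mul_mul_conjTranspose_same _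

theorem IsCP.posSemidef_map {Φ : Op m →ₗ[ℂ] Op n} (hΦ : IsCP Φ) {A : Op m}
    (hA : A.PosSemidef) : (Φ A).PosSemidef := by
  rw [isCP_iff] at hΦ
  have h := hΦ 1 (fun _ _ => A) (by
    have : Matrix.comp (Fin 1) (Fin 1) m m ℂ (fun _ _ => A) = A.submatrix Prod.snd Prod.snd := by
      ext ⟨i, a⟩ ⟨j, b⟩; rfl
    rw [this]
    exact hA.submatrix _)
  exact h.submatrix (fun a => ((0 : Fin 1), a))

open scoped MatrixOrder Matrix.Norms.L2Operator CStarAlgebra in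
omit [DecidableEq n] in
theorem trace_mul_nonneg {A B : Op n} (hA : A.PosSemidef) (hB : B.PosSemidef) :
    0 ≤ (A * B).trace := by
  classical
  obtain ⟨C, rfl⟩ := CStarAlgebra.nonneg_iff_eq_star_mul_self.mp hA.nonneg
  rw [Matrix.star_eq_conjTranspose]
  rw [Matrix.mul_assoc, Matrix.trace_mul_comm]
  exact (hB.mul_mul_conjTranspose_same C).trace_nonneg

/-- By duality, the quadratic form of the adjoint at v is the trace of the positive operator
Φ(|v⟩⟨v|) against A. -/
theorem adjointMap_posSemidef {Φ : Op m →ₗ[ℂ] Op n} (hΦ : IsCP Φ) {A : Op n}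
    (hA : A.PosSemidef) : (adjointMap Φ A).PosSemidef := by
  have h (v : m → ℂ) : 0 ≤ star v ⬝ᵥ (adjointMap Φ A).mulVec v := by
    have h1 := trace_mul_adjointMap Φ (Matrix.vecMulVec v (star v)) A
    have h2 : (Matrix.vecMulVec v (star v) * adjointMap Φ A).trace =
        star v ⬝ᵥ (adjointMap Φ A).mulVec v := by
      rw [Matrix.vecMulVec_mul, Matrix.trace_vecMulVec, Matrix.dotProduct_mulVec, dotProduct_comm]
    rw [← h2, h1]
    exact trace_mul_nonneg (hΦ.posSemidef_map (Matrix.posSemidef_vecMulVec_self_star v)) hA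
  rw [← Matrix.isPositive_toEuclideanLin_iff, LinearMap.isPositive_iff_complex]
  intro x
  have h1 : inner ℂ (Matrix.toEuclideanLin (adjointMap Φ A) x) x =
      star (star (x : m → ℂ) ⬝ᵥ (adjointMap Φ A).mulVec x) := by
    rw [Matrix.star_dotProduct, dotProduct_comm]
    simp [EuclideanSpace.inner_eq_star_dotProduct, Matrix.toLpLin_apply]
  have h2 := h x
  rw [← star_nonneg_iff, ← h1, Complex.nonneg_iff] at h2
  exact ⟨Complex.ext rfl h2.2, h2.1⟩

omit [DecidableEq n] in
theorem adjointMap_ext {Φ Ψ : Op m →ₗ[ℂ] Op n} (h : adjointMap Φ = adjointMap Ψ) : Φ = Ψ := by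
  ext1 ρ
  rw [Matrix.ext_iff_trace_mul_right]
  intro A
  rw [← trace_mul_adjointMap, ← trace_mul_adjointMap, h]

omit [DecidableEq n] in
theorem adjointMap_eq_of_trace {Φ : Op m →ₗ[ℂ] Op n} {A : Op n} {B : Op m}
    (h : ∀ ρ, (ρ * B).trace = (Φ ρ * A).trace) : adjointMap Φ A = B := by
  rw [Matrix.ext_iff_trace_mul_left]
  intro ρ
  rw [trace_mul_adjointMap, h]

end CPMaps

/-! ### Sharp meters and white noise -/

section SharpMeters
variable {d : ℕ}

theorem IsSharpMeter.exists_unitary {Q : Fin d → Op (Fin d)} (hQ : IsSharpMeter Q) :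
    ∃ U : Op (Fin d), U.conjTranspose * U = 1 ∧
      ∀ x, Q x = U * Matrix.single x x 1 * U.conjTranspose := by
  obtain ⟨φ, hφ⟩ := hQ
  refine ⟨Matrix.of fun i x => φ x i, ?_, fun x => ?_⟩
  · ext x y
    have h := orthonormal_iff_ite.mp φ.orthonormal x y
    rw [EuclideanSpace.inner_eq_star_dotProduct, dotProduct_comm] at h
    rw [Matrix.one_apply, ← h]
    rfl
  · rw [hφ]
    ext i j
    simp [Matrix.mul_apply, Matrix.single_apply, ite_and]

theorem isSharpMeter_of_unitary {U : Op (Fin d)} (hU : U.conjTranspose * U = 1)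
    {Q : Fin d → Op (Fin d)} (hQ : ∀ x, Q x = U * Matrix.single x x 1 * U.conjTranspose) :
    IsSharpMeter Q := by
  have ho : Orthonormal ℂ ((Set.univ : Set (Fin d)).domRestrict
      fun x => WithLp.toLp 2 fun i => U i x) := by
    rw [orthonormal_iff_ite]
    rintro ⟨x, -⟩ ⟨y, -⟩
    have h := congrFun (congrFun hU x) y
    rw [Matrix.one_apply] at h
    simp only [Subtype.mk.injEq]
    rw [← h]
    simp [EuclideanSpace.inner_eq_star_dotProduct, Set.domRestrict, dotProduct, Matrix.mul_apply,
      mul_comm]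
  obtain ⟨b, hb⟩ := ho.exists_orthonormalBasis_extension_of_card_eq (by simp)
  refine ⟨b, fun x => ?_⟩
  rw [hQ, hb x (Set.mem_univ x)]
  ext i j
  simp [Matrix.mul_apply, Matrix.single_apply, ite_and]

/-- Every unit vector spans the range of an element of a sharp meter. -/
theorem exists_isSharpMeter (v : Fin d → ℂ) (hv : star v ⬝ᵥ v = 1) (y : Fin d) :
    ∃ P : Fin d → Op (Fin d), IsSharpMeter P ∧ P y = Matrix.vecMulVec v (star v) := by
  have ho : Orthonormal ℂ (({y} : Set (Fin d)).domRestrict fun _ => WithLp.toLp 2 v) := by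
    rw [orthonormal_iff_ite]
    rintro ⟨x, rfl⟩ ⟨z, rfl⟩
    rw [if_pos rfl, EuclideanSpace.inner_eq_star_dotProduct, dotProduct_comm]
    exact hv
  obtain ⟨b, hb⟩ := ho.exists_orthonormalBasis_extension_of_card_eq (by simp)
  refine ⟨fun x => Matrix.of fun i j => b x i * star (b x j), ⟨b, fun _ => rfl⟩, ?_⟩
  ext i j
  simp [hb y rfl, Matrix.vecMulVec_apply]

theorem IsSharpMeter.conj {Q : Fin d → Op (Fin d)} (hQ : IsSharpMeter Q) {U : Op (Fin d)}
    (hU : U.conjTranspose * U = 1) :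
    IsSharpMeter fun x => U * Q x * U.conjTranspose := by
  obtain ⟨V, hV, hQV⟩ := hQ.exists_unitary
  refine isSharpMeter_of_unitary (U := U * V) ?_ fun x => ?_
  · rw [Matrix.conjTranspose_mul, Matrix.mul_assoc, ← Matrix.mul_assoc _ U, hU, Matrix.one_mul, hV]
  · simp only [hQV, Matrix.conjTranspose_mul, Matrix.mul_assoc]

theorem isSharpMeter_single : IsSharpMeter fun x : Fin d => Matrix.single x x (1 : ℂ) :=
  isSharpMeter_of_unitary (U := 1) (by simp) fun x => by simp

theorem IsSharpMeter.posSemidef {Q : Fin d → Op (Fin d)} (hQ : IsSharpMeter Q) (x : Fin d) :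
    (Q x).PosSemidef := by
  obtain ⟨φ, hφ⟩ := hQ
  rw [hφ]
  exact Matrix.posSemidef_vecMulVec_self_star (φ x : Fin d → ℂ)

theorem IsSharpMeter.sum_eq_one {Q : Fin d → Op (Fin d)} (hQ : IsSharpMeter Q) :
    ∑ x, Q x = 1 := by
  obtain ⟨U, hU, hQ⟩ := hQ.exists_unitary
  simp only [hQ]
  rw [← Finset.sum_mul, ← Finset.mul_sum]
  have : ∑ x : Fin d, Matrix.single x x (1 : ℂ) = 1 := by
    ext i j
    simp [Matrix.sum_apply, Matrix.single_apply, Matrix.one_apply, ite_and]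
  rw [this, Matrix.mul_one, mul_eq_one_comm.mp hU]

theorem IsSharpMeter.trace_eq_one {Q : Fin d → Op (Fin d)} (hQ : IsSharpMeter Q) (x : Fin d) :
    (Q x).trace = 1 := by
  obtain ⟨U, hU, hQ⟩ := hQ.exists_unitary
  rw [hQ, Matrix.trace_mul_comm, ← Matrix.mul_assoc, hU, Matrix.one_mul, Matrix.trace_single_eq_same]

theorem depolarizing_apply (r : ℝ) (A : Op (Fin d)) :
    depolarizing d r A = (r : ℂ) • A + ((1 - r : ℂ) / (d : ℂ)) • A.trace • (1 : Op (Fin d)) := by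
  simp [depolarizing]

/-- Rank-one projections have trace one. Since depolarizing maps are also self-adjoint, noise on a
meter and noise on the state become the same thing. -/
theorem IsSharpMeter.noisyMeter_eq {Q : Fin d → Op (Fin d)} (hQ : IsSharpMeter Q) (r : ℝ)
    (x : Fin d) : noisyMeter r Q x = depolarizing d r (Q x) := by
  rw [depolarizing_apply, hQ.trace_eq_one, one_smul, noisyMeter]

theorem trace_depolarizing (hd : 1 ≤ d) (r : ℝ) (A : Op (Fin d)) :
    (depolarizing d r A).trace = A.trace := by
  have : (d : ℂ) ≠ 0 := by exact_mod_cast (by omega : d ≠ 0)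
  rw [depolarizing_apply]
  simp only [Matrix.trace_add, Matrix.trace_smul, Matrix.trace_one, Fintype.card_fin, smul_eq_mul]
  field_simp
  ring

theorem adjointMap_depolarizing (r : ℝ) :
    adjointMap (depolarizing d r) = depolarizing d r := by
  ext1 A
  refine adjointMap_eq_of_trace fun ρ => ?_
  simp only [depolarizing_apply, Matrix.mul_add, Matrix.add_mul, Matrix.mul_smul, Matrix.smul_mul,
    Matrix.trace_add, Matrix.trace_smul, smul_eq_mul, Matrix.mul_one, Matrix.one_mul]
  ring

theorem sum_noisyMeter (hd : 1 ≤ d) {Q : Fin d → Op (Fin d)} (hQ : ∑ x, Q x = 1) (r : ℝ) :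
    ∑ x, noisyMeter r Q x = 1 := by
  have : (d : ℂ) ≠ 0 := by exact_mod_cast (by omega : d ≠ 0)
  simp only [noisyMeter, Finset.sum_add_distrib, ← Finset.smul_sum, hQ, Finset.sum_const,
    Finset.card_univ, Fintype.card_fin]
  rw [← Nat.cast_smul_eq_nsmul ℂ, smul_smul, ← add_smul]
  convert one_smul ℂ (1 : Op (Fin d)) using 2
  field_simp
  ring

end SharpMeters

/-! ### Partial traces and measuring one output -/

section PartialTraces
variable {n : Type} [Fintype n] [DecidableEq n]

theorem trace_firstClone_mul (R : Op (n × n)) (A : Op n) :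
    (firstClone n R * A).trace = (R * (A ⊗ₖ (1 : Op n))).trace := by
  simp only [Matrix.trace, Matrix.diag_apply, Matrix.mul_apply, firstClone, LinearMap.coe_mk,
    AddHom.coe_mk, Matrix.of_apply, Fintype.sum_prod_type, Matrix.kroneckerMap_apply,
    Matrix.one_apply, mul_ite, mul_one, mul_zero, Finset.sum_ite_eq', Finset.mem_univ, if_true,
    Finset.sum_mul]
  exact Finset.sum_congr rfl fun i _ => Finset.sum_comm

theorem trace_secondClone_mul (R : Op (n × n)) (A : Op n) :
    (secondClone n R * A).trace = (R * ((1 : Op n) ⊗ₖ A)).trace := by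
  simp only [Matrix.trace, Matrix.diag_apply, Matrix.mul_apply, secondClone, LinearMap.coe_mk,
    AddHom.coe_mk, Matrix.of_apply, Fintype.sum_prod_type, Matrix.kroneckerMap_apply,
    Matrix.one_apply, ite_mul, one_mul, zero_mul, mul_ite, mul_zero, Finset.sum_mul]
  rw [Finset.sum_congr rfl fun i _ => Finset.sum_comm, Finset.sum_comm]
  refine Finset.sum_congr rfl fun i _ => Finset.sum_congr rfl fun j _ => ?_
  rw [Finset.sum_comm]
  simp

theorem trace_firstClone (R : Op (n × n)) : (firstClone n R).trace = R.trace := by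
  simpa using trace_firstClone_mul R 1

theorem trace_secondClone (R : Op (n × n)) : (secondClone n R).trace = R.trace := by
  simpa using trace_secondClone_mul R 1

theorem adjointMap_kronecker_one {m : Type} [Fintype m] [DecidableEq m]
    (Γ : Op m →ₗ[ℂ] Op (n × n)) (A : Op n) :
    adjointMap Γ (A ⊗ₖ (1 : Op n)) = adjointMap (firstClone n ∘ₗ Γ) A :=
  adjointMap_eq_of_trace fun ρ => by
    rw [trace_mul_adjointMap, LinearMap.comp_apply, trace_firstClone_mul]

theorem adjointMap_one_kronecker {m : Type} [Fintype m] [DecidableEq m]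
    (Γ : Op m →ₗ[ℂ] Op (n × n)) (A : Op n) :
    adjointMap Γ ((1 : Op n) ⊗ₖ A) = adjointMap (secondClone n ∘ₗ Γ) A :=
  adjointMap_eq_of_trace fun ρ => by
    rw [trace_mul_adjointMap, LinearMap.comp_apply, trace_secondClone_mul]

/-- The operator `⟨v| ⊗ 1`. -/
def contraction (v : n → ℂ) : Matrix n (n × n) ℂ :=
  Matrix.of fun j p => star (v p.1) * (1 : Op n) j p.2

theorem contraction_sandwich (v : n → ℂ) (A : Op n) :
    (contraction v).conjTranspose * A * contraction v =
      Matrix.vecMulVec v (star v) ⊗ₖ A := by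
  ext ⟨i, j⟩ ⟨k, l⟩
  simp [contraction, Matrix.mul_apply, Matrix.one_apply, Matrix.vecMulVec_apply, apply_ite,
    ite_mul]
  ring

/-- Measuring a sharp meter on the first output of a completely positive map. -/
theorem IsSharpMeter.exists_instrument {d : ℕ} {Q : Fin d → Op (Fin d)} (hQ : IsSharpMeter Q)
    {Γ : Op (Fin d) →ₗ[ℂ] Op (Fin d × Fin d)} (hΓ : IsCP Γ) :
    ∃ J : Fin d → Op (Fin d) →ₗ[ℂ] Op (Fin d), (∀ x, IsCP (J x)) ∧
      (∀ x A, adjointMap (J x) A = adjointMap Γ (Q x ⊗ₖ A)) ∧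
      ∑ x, J x = secondClone (Fin d) ∘ₗ Γ := by
  have hsum := hQ.sum_eq_one
  obtain ⟨φ, hφ⟩ := hQ
  have hφ' (x) : Q x = Matrix.vecMulVec (φ x : Fin d → ℂ) (star (φ x : Fin d → ℂ)) := hφ x
  have key (x) (R : Op (Fin d × Fin d)) (A : Op (Fin d)) :
      (conjMap (contraction (φ x : Fin d → ℂ)) R * A).trace = (R * (Q x ⊗ₖ A)).trace := by
    rw [hφ', ← contraction_sandwich, conjMap_apply, Matrix.mul_assoc, Matrix.mul_assoc,
      Matrix.trace_mul_comm, Matrix.mul_assoc]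
  refine ⟨fun x => conjMap (contraction (φ x : Fin d → ℂ)) ∘ₗ Γ,
    fun x => (isCP_conjMap _).comp hΓ, fun x A => adjointMap_eq_of_trace fun ρ => ?_, ?_⟩
  · rw [trace_mul_adjointMap, LinearMap.comp_apply, key]
  · ext1 ρ
    rw [Matrix.ext_iff_trace_mul_right]
    intro A
    rw [LinearMap.comp_apply, trace_secondClone_mul, ← hsum, LinearMap.sum_apply, Finset.sum_mul,
      Matrix.trace_sum]
    simp only [LinearMap.comp_apply, key]
    rw [← Matrix.trace_sum, ← Finset.mul_sum]
    congr 2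
    ext ⟨i, j⟩ ⟨k, l⟩
    simp [Matrix.sum_apply, Finset.sum_mul]

end PartialTraces

/-! ### The inclusions that need no computation -/

section Inclusions
variable {d : ℕ}

/-- Summing out one meter puts the identity on its factor, which leaves the adjoint of the other
marginal channel. -/
theorem cloningMeter_isJointMeter (hd : 1 ≤ d) {Γ : Op (Fin d) →ₗ[ℂ] Op (Fin d × Fin d)} {s t : ℝ}
    (hΓ : IsJointChannel Γ (depolarizing d s) (depolarizing d t)) {Q P : Fin d → Op (Fin d)}
    (hQ : IsSharpMeter Q) (hP : IsSharpMeter P) :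
    IsJointMeter (cloningMeter Γ Q P) (noisyMeter s Q) (noisyMeter t P) := by
  obtain ⟨hC, h1, h2⟩ := hΓ
  have hrow (x) : ∑ y, cloningMeter Γ Q P (x, y) = noisyMeter s Q x := by
    simp only [cloningMeter]
    rw [← map_sum, hQ.noisyMeter_eq, ← adjointMap_depolarizing s, ← h1, ← adjointMap_kronecker_one,
      ← hP.sum_eq_one]
    congr 1
    ext ⟨i, j⟩ ⟨k, l⟩
    simp [Matrix.sum_apply, Finset.mul_sum]
  refine ⟨⟨fun z => adjointMap_posSemidef hC.1
    ((hQ.posSemidef _).kronecker (hP.posSemidef _)), ?_⟩, hrow, fun y => ?_⟩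
  · rw [Fintype.sum_prod_type]
    simp only [hrow, sum_noisyMeter hd hQ.sum_eq_one]
  · simp only [cloningMeter]
    rw [← map_sum, hP.noisyMeter_eq, ← adjointMap_depolarizing t, ← h2, ← adjointMap_one_kronecker,
      ← hQ.sum_eq_one]
    congr 1
    ext ⟨i, j⟩ ⟨k, l⟩
    simp [Matrix.sum_apply, Finset.sum_mul]

theorem regionII_subset_cloningTradeoff (hd : 1 ≤ d) {Q P : Fin d → Op (Fin d)}
    (hQ : IsSharpMeter Q) (hP : IsSharpMeter P) : regionII d ⊆ cloningTradeoff Q P := by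
  rintro ⟨s, t⟩ ⟨hs, ht, Γ, hΓ⟩
  exact ⟨hs, ht, Γ, ⟨hΓ.1, fun Q' P' hQ' hP' => ⟨s, hs, t, ht,
    cloningMeter_isJointMeter hd hΓ hQ' hP'⟩⟩, cloningMeter_isJointMeter hd hΓ hQ hP⟩

/-- The instrument clones, measures Q on the first clone and outputs the second; it yields the same
joint meters as the cloner. -/
theorem cloningTradeoff_subset_sequentialTradeoff {Q P : Fin d → Op (Fin d)}
    (hQ : IsSharpMeter Q) : cloningTradeoff Q P ⊆ sequentialTradeoff Q P := by
  rintro ⟨s, t⟩ ⟨hs, ht, Γ, ⟨hΓ, hU⟩, hJ⟩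
  obtain ⟨J, hJcp, hadj, hsum⟩ := hQ.exists_instrument hΓ.1
  have heq (N : Fin d → Op (Fin d)) : sequentialMeter J N = cloningMeter Γ Q N :=
    funext fun z => hadj _ _
  refine ⟨hs, ht, J, ⟨⟨hJcp, IsCP.sum _ hJcp, fun ρ hρ => ?_⟩, fun P' hP' => ?_⟩, ?_⟩
  · rw [hsum, LinearMap.comp_apply, trace_secondClone, hΓ.2 ρ hρ]
  · rw [heq]
    exact hU Q P' hQ hP'
  · rwa [heq]

theorem regionII_subset_regionQI (hd : 1 ≤ d) {Q : Fin d → Op (Fin d)} (hQ : IsSharpMeter Q) :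
    regionII d ⊆ regionQI Q := by
  rintro ⟨s, t⟩ ⟨hs, ht, Γ, hΓ, h1, h2⟩
  obtain ⟨J, hJcp, hadj, hsum⟩ := hQ.exists_instrument hΓ.1
  refine ⟨hs, ht, J, ⟨hJcp, IsCP.sum _ hJcp, fun ρ hρ => ?_⟩, fun x => ?_, hsum.trans h2⟩
  · rw [hsum, h2, trace_depolarizing hd, hρ.2]
  · rw [hadj, adjointMap_kronecker_one, h1, adjointMap_depolarizing, hQ.noisyMeter_eq]

end Inclusions

/-! ### Asymmetric cloners: sufficiency of the inequality -/

section Cloners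
variable {d : ℕ}

/-- The Kraus operator `ψ ↦ a ψ ⊗ e_y + b e_y ⊗ ψ`. -/
def clonerKraus (a b : ℝ) (y : Fin d) : Matrix (Fin d × Fin d) (Fin d) ℂ :=
  Matrix.of fun p k => a * ((1 : Op (Fin d)) p.1 k * (1 : Op (Fin d)) p.2 y) +
    b * ((1 : Op (Fin d)) p.1 y * (1 : Op (Fin d)) p.2 k)

/-- The map `ρ ↦ (a + b S) (ρ ⊗ 1) (a + b S)`, with `S` the swap. -/
def clonerMap (d : ℕ) (a b : ℝ) : Op (Fin d) →ₗ[ℂ] Op (Fin d × Fin d) :=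
  ∑ y, conjMap (clonerKraus a b y)

theorem isCP_clonerMap (a b : ℝ) : IsCP (clonerMap d a b) :=
  IsCP.sum _ fun _ => isCP_conjMap _

theorem clonerKraus_mul_apply (a b : ℝ) (y : Fin d) (N : Op (Fin d)) (p : Fin d × Fin d)
    (m : Fin d) : (clonerKraus a b y * N) p m =
      a * (1 : Op (Fin d)) p.2 y * N p.1 m + b * (1 : Op (Fin d)) p.1 y * N p.2 m := by
  simp only [Matrix.mul_apply, clonerKraus, Matrix.of_apply, add_mul, Finset.sum_add_distrib]
  congr 1
  · rw [Finset.sum_eq_single p.1 (fun k _ hk => by simp [Matrix.one_apply_ne' hk]) (by simp)]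
    simp
  · rw [Finset.sum_eq_single p.2 (fun k _ hk => by simp [Matrix.one_apply_ne' hk]) (by simp)]
    simp

theorem mul_clonerKraus_conjTranspose_apply (a b : ℝ) (y : Fin d)
    (N : Matrix (Fin d × Fin d) (Fin d) ℂ) (q p : Fin d × Fin d) :
    (N * (clonerKraus a b y).conjTranspose) q p =
      a * (1 : Op (Fin d)) p.2 y * N q p.1 + b * (1 : Op (Fin d)) p.1 y * N q p.2 := by
  have hs (i j : Fin d) : star ((1 : Op (Fin d)) i j) = (1 : Op (Fin d)) i j := by
    rw [Matrix.one_apply]; split_ifs <;> simp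
  simp only [Matrix.mul_apply, clonerKraus, Matrix.of_apply, Matrix.conjTranspose_apply, star_add,
    star_mul', hs, mul_add, Finset.sum_add_distrib]
  congr 1
  · rw [Finset.sum_eq_single p.1 (fun k _ hk => by simp [Matrix.one_apply_ne' hk]) (by simp)]
    simp
    ring
  · rw [Finset.sum_eq_single p.2 (fun k _ hk => by simp [Matrix.one_apply_ne' hk]) (by simp)]
    simp
    ring

theorem clonerMap_apply (a b : ℝ) (ρ : Op (Fin d)) (i j k l : Fin d) :
    clonerMap d a b ρ (i, j) (k, l) =
      a ^ 2 * (ρ i k * (1 : Op (Fin d)) j l) + b ^ 2 * ((1 : Op (Fin d)) i k * ρ j l) +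
      a * b * (ρ i l * (1 : Op (Fin d)) j k + (1 : Op (Fin d)) i l * ρ j k) := by
  have h (y : Fin d) : conjMap (clonerKraus a b y) ρ (i, j) (k, l) =
      (a * (1 : Op (Fin d)) j y) * (a * (1 : Op (Fin d)) l y) * ρ i k +
      (a * (1 : Op (Fin d)) j y) * (b * (1 : Op (Fin d)) k y) * ρ i l +
      (b * (1 : Op (Fin d)) i y) * (a * (1 : Op (Fin d)) l y) * ρ j k +
      (b * (1 : Op (Fin d)) i y) * (b * (1 : Op (Fin d)) k y) * ρ j l := by
    rw [conjMap_apply, mul_clonerKraus_conjTranspose_apply, clonerKraus_mul_apply,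
      clonerKraus_mul_apply]
    ring
  simp only [clonerMap, LinearMap.sum_apply, Matrix.sum_apply, h, Finset.sum_add_distrib,
    ← Finset.sum_mul]
  simp only [Matrix.one_apply, mul_ite, ite_mul, mul_one, mul_zero, zero_mul, Finset.sum_ite_eq,
      Finset.mem_univ, if_true, one_mul]
  split_ifs <;> ring

theorem firstClone_clonerMap (a b : ℝ) (ρ : Op (Fin d)) :
    firstClone (Fin d) (clonerMap d a b ρ) =
      (a ^ 2 * d + 2 * a * b : ℂ) • ρ + (b ^ 2 : ℂ) • ρ.trace • (1 : Op (Fin d)) := by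
  ext i k
  simp only [firstClone, LinearMap.coe_mk, AddHom.coe_mk, Matrix.of_apply, clonerMap_apply,
    Finset.sum_add_distrib, ← Finset.mul_sum, Matrix.add_apply, Matrix.smul_apply, smul_eq_mul,
    Matrix.trace, Matrix.diag_apply]
  simp [Matrix.one_apply]
  ring

theorem secondClone_clonerMap (a b : ℝ) (ρ : Op (Fin d)) :
    secondClone (Fin d) (clonerMap d a b ρ) =
      (b ^ 2 * d + 2 * a * b : ℂ) • ρ + (a ^ 2 : ℂ) • ρ.trace • (1 : Op (Fin d)) := by
  ext i k
  simp only [secondClone, LinearMap.coe_mk, AddHom.coe_mk, Matrix.of_apply, clonerMap_apply,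
    Finset.sum_add_distrib, ← Finset.mul_sum, Matrix.add_apply, Matrix.smul_apply, smul_eq_mul,
    Matrix.trace, Matrix.diag_apply, ← Finset.sum_mul]
  simp [Matrix.one_apply]
  ring

/-- The map `ρ ↦ tr(ρ) 1`. -/
def traceOut (d : ℕ) : Op (Fin d) →ₗ[ℂ] Op (Fin d × Fin d) :=
  (Matrix.traceLinearMap (Fin d) ℂ ℂ).smulRight (1 : Op (Fin d × Fin d))

theorem traceOut_apply (ρ : Op (Fin d)) : traceOut d ρ = ρ.trace • (1 : Op (Fin d × Fin d)) := rfl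

theorem isCP_traceOut : IsCP (traceOut d) := by
  -- Kraus operators |p⟩⟨i|.
  have h : traceOut d = ∑ p : Fin d × Fin d, ∑ i : Fin d, conjMap (Matrix.single p i 1) := by
    ext1 ρ
    ext q r
    simp [traceOut_apply, LinearMap.sum_apply, Matrix.sum_apply, conjMap_apply, Matrix.one_apply,
      Matrix.trace, Matrix.single_apply, ite_and, Finset.sum_ite_irrel]
  rw [h]
  exact IsCP.sum _ fun p => IsCP.sum _ fun i => isCP_conjMap _

theorem firstClone_one : firstClone (Fin d) 1 = (d : ℂ) • (1 : Op (Fin d)) := by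
  ext i k
  simp [firstClone, Matrix.one_apply]

theorem secondClone_one : secondClone (Fin d) 1 = (d : ℂ) • (1 : Op (Fin d)) := by
  ext i k
  simp [secondClone, Matrix.one_apply]

/-- A mixture of a coherent cloner a + bS, the two trivial cloners that hand ρ to one side and noise
to the other (weights u, v), and pure noise (weight w). The cross term 2ab/d is the gain from the
swap: it enters both s and t but is counted only once in the normalization. -/
theorem mem_regionII_of_coefficients (hd : 1 ≤ d) {s t a b u v w : ℝ}
    (hs : s ∈ Set.Icc (0 : ℝ) 1) (ht : t ∈ Set.Icc (0 : ℝ) 1)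
    (hu : 0 ≤ u) (hv : 0 ≤ v) (hw : 0 ≤ w) (h1 : s = a ^ 2 + 2 * a * b / d + u)
    (h2 : t = b ^ 2 + 2 * a * b / d + v)
    (h3 : a ^ 2 + b ^ 2 + 2 * a * b / d + u + v + w = 1) : (s, t) ∈ regionII d := by
  have hd0 : (d : ℂ) ≠ 0 := by exact_mod_cast (by omega : d ≠ 0)
  have hn : (0 : ℝ) ≤ d := Nat.cast_nonneg d
  have h1' : (s : ℂ) = a ^ 2 + 2 * a * b / d + u := by exact_mod_cast congrArg Complex.ofReal h1
  have h2' : (t : ℂ) = b ^ 2 + 2 * a * b / d + v := by exact_mod_cast congrArg Complex.ofReal h2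
  have h3' : (w : ℂ) = 1 - (a ^ 2 + b ^ 2 + 2 * a * b / d + u + v) := by
    have : w = 1 - (a ^ 2 + b ^ 2 + 2 * a * b / d + u + v) := by linarith
    exact_mod_cast congrArg Complex.ofReal this
  let Γ : Op (Fin d) →ₗ[ℂ] Op (Fin d × Fin d) :=
    ((1 / d : ℝ) : ℂ) • clonerMap d a b + ((u / d : ℝ) : ℂ) • clonerMap d 1 0 +
      ((v / d : ℝ) : ℂ) • clonerMap d 0 1 + ((w / d ^ 2 : ℝ) : ℂ) • traceOut d
  have hcp : IsCP Γ :=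
    ((((isCP_clonerMap a b).smul (by positivity)).add
      ((isCP_clonerMap 1 0).smul (by positivity))).add
      ((isCP_clonerMap 0 1).smul (by positivity))).add (isCP_traceOut.smul (by positivity))
  have hf : firstClone (Fin d) ∘ₗ Γ = depolarizing d s := by
    ext1 ρ
    simp only [Γ, LinearMap.comp_apply, LinearMap.add_apply, LinearMap.smul_apply, map_add,
      map_smul, firstClone_clonerMap, traceOut_apply, firstClone_one, depolarizing_apply]
    match_scalars
    · rw [h1']
      field_simp
      ring
    · rw [h3', h1']
      field_simp
      ring
  have hg : secondClone (Fin d) ∘ₗ Γ = depolarizing d t := by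
    ext1 ρ
    simp only [Γ, LinearMap.comp_apply, LinearMap.add_apply, LinearMap.smul_apply, map_add,
      map_smul, secondClone_clonerMap, traceOut_apply, secondClone_one, depolarizing_apply]
    match_scalars
    · rw [h2']
      field_simp
      ring
    · rw [h3', h2']
      field_simp
      ring
  refine ⟨hs, ht, Γ, ⟨hcp, fun ρ hρ => ?_⟩, hf, hg⟩
  rw [← trace_firstClone, ← LinearMap.comp_apply, hf, trace_depolarizing hd, hρ.2]

/-- If s + t ≤ 1, mixing trivial cloners suffices. Otherwise the excess s + t - 1 has to equal the
interference term 2ab/d. With b = √(1-s) this fixes a, and the inequality says exactly that a ≤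
√(1-t) is possible; the weight u = 1 - t - a² restores the normalization. -/
theorem mem_regionII_of_le (hd : 1 ≤ d) {s t : ℝ}
    (hs : s ∈ Set.Icc (0 : ℝ) 1) (ht : t ∈ Set.Icc (0 : ℝ) 1)
    (h : s + t ≤ 1 + 2 * (√(1 - s) * √(1 - t)) / d) : (s, t) ∈ regionII d := by
  have hd0 : (0 : ℝ) < d := by exact_mod_cast hd
  rcases le_total (s + t) 1 with h1 | h1
  · exact mem_regionII_of_coefficients hd (a := 0) (b := 0) (u := s) (v := t) (w := 1 - s - t)
      hs ht hs.1 ht.1 (by linarith) (by simp) (by simp) (by ring)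
  set α := √(1 - t)
  set β := √(1 - s)
  have hα : α ^ 2 = 1 - t := Real.sq_sqrt (by linarith [ht.2])
  have hβ : β ^ 2 = 1 - s := Real.sq_sqrt (by linarith [hs.2])
  have hα0 : 0 ≤ α := Real.sqrt_nonneg _
  have hβ0 : 0 ≤ β := Real.sqrt_nonneg _
  have h2 : (s + t - 1) * d / 2 ≤ β * α := by
    rw [div_le_iff₀ two_pos, ← le_div_iff₀ hd0, mul_comm _ (2 : ℝ)]
    linarith
  have h3 : 0 ≤ (s + t - 1) * d / 2 := by
    have : 0 ≤ s + t - 1 := by linarith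
    positivity
  obtain ⟨a, ha0, ha1, hab⟩ : ∃ a, 0 ≤ a ∧ a ≤ α ∧ a * β = (s + t - 1) * d / 2 := by
    -- For β = 0 the right side is both nonnegative and at most 0, so a = 0 works.
    rcases hβ0.eq_or_lt with h0 | h0
    · exact ⟨0, le_rfl, hα0, by rw [← h0] at h2 ⊢; linarith⟩
    · refine ⟨(s + t - 1) * d / 2 / β, by positivity, ?_, by field_simp⟩
      rw [div_le_iff₀ h0]
      linarith
  have hab' : 2 * a * β / d = s + t - 1 := by
    rw [mul_assoc, hab]
    field_simp
  refine mem_regionII_of_coefficients hd (a := a) (b := β) (u := α ^ 2 - a ^ 2) (v := 0) (w := 0)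
    hs ht ?_ le_rfl le_rfl ?_ ?_ ?_
  · nlinarith
  · linarith
  · linarith
  · linarith

/-- In dimension one ρ = tr(ρ) 1, so noise has no effect and the region is the whole square. The
inequality fails there at (1, 1), hence the separate case. -/
theorem mem_regionII_one {s t : ℝ} (hs : s ∈ Set.Icc (0 : ℝ) 1) (ht : t ∈ Set.Icc (0 : ℝ) 1) :
    (s, t) ∈ regionII 1 := by
  have h (r : ℝ) : depolarizing 1 r = depolarizing 1 0 := by
    ext1 ρ
    ext i j
    have hi : i = 0 := Subsingleton.elim _ _
    have hj : j = 0 := Subsingleton.elim _ _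
    subst hi hj
    simp only [depolarizing_apply]
    simp [Matrix.trace]
    ring
  obtain ⟨-, -, Γ, hΓ⟩ := mem_regionII_of_le (d := 1) (s := 0) (t := 0) le_rfl (by simp) (by simp)
    (by norm_num)
  exact ⟨hs, ht, Γ, by rwa [h s, h t]⟩

end Cloners

/-! ### Change of orthonormal basis -/

section Covariance
variable {d : ℕ}

theorem conjMap_depolarizing {U : Op (Fin d)} (hU : U.conjTranspose * U = 1) (r : ℝ)
    (A : Op (Fin d)) : conjMap U (depolarizing d r A) = depolarizing d r (conjMap U A) := by
  have h1 : U * U.conjTranspose = 1 := mul_eq_one_comm.mp hU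
  have h2 : (conjMap U A).trace = A.trace := by
    rw [conjMap_apply, Matrix.trace_mul_comm, ← Matrix.mul_assoc, hU, Matrix.one_mul]
  have h3 : conjMap U 1 = 1 := by rw [conjMap_apply, Matrix.mul_one, h1]
  rw [depolarizing_apply, depolarizing_apply, map_add, map_smul, map_smul, map_smul, h2, h3]

theorem conjMap_conjTranspose_apply {U : Op (Fin d)} (hU : U.conjTranspose * U = 1)
    (A : Op (Fin d)) : conjMap U.conjTranspose (conjMap U A) = A := by
  simp only [conjMap_apply, Matrix.conjTranspose_conjTranspose, ← Matrix.mul_assoc, hU,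
    Matrix.one_mul]
  rw [Matrix.mul_assoc, hU, Matrix.mul_one]

theorem conjMap_apply_conjTranspose {U : Op (Fin d)} (hU : U.conjTranspose * U = 1)
    (A : Op (Fin d)) : conjMap U (conjMap U.conjTranspose A) = A := by
  have := conjMap_conjTranspose_apply (U := U.conjTranspose)
    (by rw [Matrix.conjTranspose_conjTranspose]; exact mul_eq_one_comm.mp hU) A
  rwa [Matrix.conjTranspose_conjTranspose] at this

/-- The map `Φ` in the coordinates given by the unitary `U`. -/
def rotate (U : Op (Fin d)) (Φ : Op (Fin d) →ₗ[ℂ] Op (Fin d)) : Op (Fin d) →ₗ[ℂ] Op (Fin d) :=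
  conjMap U.conjTranspose ∘ₗ Φ ∘ₗ conjMap U

theorem rotate_apply (U : Op (Fin d)) (Φ : Op (Fin d) →ₗ[ℂ] Op (Fin d)) (A : Op (Fin d)) :
    rotate U Φ A = conjMap U.conjTranspose (Φ (conjMap U A)) := rfl

theorem rotate_depolarizing {U : Op (Fin d)} (hU : U.conjTranspose * U = 1) (r : ℝ) :
    rotate U (depolarizing d r) = depolarizing d r := by
  ext1 A
  rw [rotate_apply, ← conjMap_depolarizing hU, conjMap_conjTranspose_apply hU]

theorem rotate_injective {U : Op (Fin d)} (hU : U.conjTranspose * U = 1)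
    {Φ Ψ : Op (Fin d) →ₗ[ℂ] Op (Fin d)} (h : rotate U Φ = rotate U Ψ) : Φ = Ψ := by
  ext1 A
  have := congrArg (conjMap U) (LinearMap.congr_fun h (conjMap U.conjTranspose A))
  simpa only [rotate_apply, conjMap_apply_conjTranspose hU] using this

theorem adjointMap_rotate {U : Op (Fin d)} (Φ : Op (Fin d) →ₗ[ℂ] Op (Fin d)) :
    adjointMap (rotate U Φ) = rotate U (adjointMap Φ) := by
  have key (V A B : Op (Fin d)) :
      (conjMap V A * B).trace = (A * conjMap V.conjTranspose B).trace := by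
    rw [conjMap_apply, conjMap_apply, Matrix.conjTranspose_conjTranspose, Matrix.mul_assoc,
      Matrix.mul_assoc, Matrix.trace_mul_comm]
    simp only [Matrix.mul_assoc]
  ext1 A
  refine adjointMap_eq_of_trace fun ρ => ?_
  rw [rotate_apply, rotate_apply, key, Matrix.conjTranspose_conjTranspose, ← key,
    trace_mul_adjointMap]

end Covariance

/-! ### Rigidity: the noise cannot depend on the meter -/

section Constancy
variable {d : ℕ}

/-- On coherences between two basis vectors, a linear map sending sharp meters to their noisy
versions agrees with the depolarizing map. -/
theorem map_coherence_eq (hd : 1 ≤ d) {L : Op (Fin d) →ₗ[ℂ] Op (Fin d)} {t : ℝ}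
    (h0 : ∀ y, L (Matrix.single y y 1) = depolarizing d t (Matrix.single y y 1))
    (h : ∀ P, IsSharpMeter P → ∃ r, ∀ y, L (P y) = noisyMeter r P y) {k l : Fin d} (hkl : k ≠ l)
    {ω : ℂ} (hω : ω * star ω = 1) :
    (L - depolarizing d t) (star ω • Matrix.single k l 1 + ω • Matrix.single l k 1) = 0 := by
  have hd0 : (d : ℂ) ≠ 0 := by exact_mod_cast (by omega : d ≠ 0)
  set X : Op (Fin d) := star ω • Matrix.single k l 1 + ω • Matrix.single l k 1 with hX
  set M := L - depolarizing d t with hM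
  have hM0 (y) : M (Matrix.single y y 1) = 0 := by
    rw [hM, LinearMap.sub_apply, h0, sub_self]
  have hω0 : ω ≠ 0 := by rintro rfl; simp at hω
  -- The projection onto a e_k + b ω e_l is a² E_kk + b² E_ll + ab X. On it `M` acts as r - t times
  -- subtraction of 1/d, while `M` kills the diagonal part.
  have key (a b : ℝ) (hab : a ^ 2 + b ^ 2 = 1) : ∃ f : ℂ, ((a * b : ℝ) : ℂ) • M X =
      f • (((a ^ 2 : ℝ) : ℂ) • Matrix.single k k 1 + ((b ^ 2 : ℝ) : ℂ) • Matrix.single l l 1 +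
        ((a * b : ℝ) : ℂ) • X - (1 / d : ℂ) • 1) := by
    have habC : (a : ℂ) ^ 2 + (b : ℂ) ^ 2 = 1 := by exact_mod_cast hab
    obtain ⟨P, hP, hPk⟩ := exists_isSharpMeter
      (Pi.single k (a : ℂ) + Pi.single l ((b : ℂ) * ω)) (by
        simp [hkl, hkl.symm, dotProduct_add]
        rw [Complex.star_def] at hω
        linear_combination habC + (b : ℂ) ^ 2 * hω) k
    have hPX : P k = ((a ^ 2 : ℝ) : ℂ) • Matrix.single k k 1 +
        ((b ^ 2 : ℝ) : ℂ) • Matrix.single l l 1 + ((a * b : ℝ) : ℂ) • X := by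
      rw [hPk, hX]
      ext i j
      simp only [Matrix.vecMulVec_apply, Pi.add_apply, Pi.star_apply, Pi.single_apply,
        Matrix.add_apply, Matrix.smul_apply, Matrix.single_apply, smul_eq_mul, Complex.ofReal_mul,
        Complex.ofReal_pow, eq_comm (a := k), eq_comm (a := l)]
      have hω' : (b : ℂ) * ω * (b * star ω) = b ^ 2 := by linear_combination (b : ℂ) ^ 2 * hω
      by_cases hik : i = k <;> by_cases hil : i = l <;> by_cases hjk : j = k <;>
        by_cases hjl : j = l <;> simp_all <;> ring
    obtain ⟨r, hr⟩ := h P hP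
    refine ⟨r - t, ?_⟩
    have h1 : M (P k) = ((r : ℂ) - t) • (P k - (1 / d : ℂ) • 1) := by
      rw [hM, LinearMap.sub_apply, hr, noisyMeter, depolarizing_apply, hP.trace_eq_one]
      match_scalars <;> (try field_simp) <;> ring
    rw [← hPX, ← h1, hPX]
    simp only [map_add, map_smul, hM0, smul_zero, zero_add]
  -- Two points of the unit circle with the same product ab but different a²: the left sides
  -- coincide. The (k, l) entries then give f = g, and the (k, k) entries give (a² - b²) f = 0.
  obtain ⟨f, hf⟩ := key (3 / 5) (4 / 5) (by norm_num)
  obtain ⟨g, hg⟩ := key (4 / 5) (3 / 5) (by norm_num)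
  have e1 := congrFun (congrFun hf k) l
  have e2 := congrFun (congrFun hg k) l
  have e3 := congrFun (congrFun hf k) k
  have e4 := congrFun (congrFun hg k) k
  simp [hX, hkl, hkl.symm] at e1 e2 e3 e4
  have hfg : f = g := by
    have : (f - g) * star ω = 0 := by
      simp only [Complex.star_def]
      linear_combination (25 / 12 : ℂ) * (e2 - e1)
    rcases mul_eq_zero.mp this with h | h
    · exact sub_eq_zero.mp h
    · exact absurd (star_eq_zero.mp h) hω0
  have hf0 : f = 0 := by
    subst hfg
    linear_combination (25 / 7 : ℂ) * (e3 - e4)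
  rw [hf0, zero_smul] at hf
  exact (smul_eq_zero.mp hf).resolve_left (by norm_num)

/-- The phases ω = 1 and ω = i separate the two matrix units in a coherence, so the difference
vanishes on all matrix units. -/
theorem eq_depolarizing_of_noisy_single (hd : 1 ≤ d) {L : Op (Fin d) →ₗ[ℂ] Op (Fin d)} {t : ℝ}
    (h0 : ∀ y, L (Matrix.single y y 1) = depolarizing d t (Matrix.single y y 1))
    (h : ∀ P, IsSharpMeter P → ∃ r, ∀ y, L (P y) = noisyMeter r P y) :
    L = depolarizing d t := by
  rw [← sub_eq_zero]
  have hzero (k l : Fin d) : (L - depolarizing d t) (Matrix.single k l 1) = 0 := by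
    by_cases hkl : k = l
    · subst hkl
      rw [LinearMap.sub_apply, h0, sub_self]
    have e1 := map_coherence_eq hd h0 h hkl (ω := 1) (by simp)
    have e2 := map_coherence_eq hd h0 h hkl (ω := Complex.I) (by simp)
    rw [map_add, map_smul, map_smul] at e1 e2
    simp only [star_one, one_smul, Complex.star_def, Complex.conj_I] at e1 e2
    have e3 := congrArg (Complex.I • ·) e2
    simp only [smul_add, smul_smul, mul_neg, Complex.I_mul_I, neg_neg, one_smul, smul_zero] at e3
    have e4 : (2 : ℂ) • (L - depolarizing d t) (Matrix.single k l 1) = 0 := by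
      linear_combination (norm := module) e1 + e3
    exact (smul_eq_zero.mp e4).resolve_left two_ne_zero
  ext1 A
  rw [Matrix.matrix_eq_sum_single A, map_sum, LinearMap.zero_apply]
  refine Finset.sum_eq_zero fun i _ => ?_
  rw [map_sum]
  refine Finset.sum_eq_zero fun j _ => ?_
  rw [← mul_one (A i j), ← smul_eq_mul, ← Matrix.smul_single, map_smul, hzero, smul_zero]

theorem eq_depolarizing_of_noisy (hd : 1 ≤ d) {L : Op (Fin d) →ₗ[ℂ] Op (Fin d)} {t : ℝ}
    {P₀ : Fin d → Op (Fin d)} (hP₀ : IsSharpMeter P₀) (h0 : ∀ y, L (P₀ y) = noisyMeter t P₀ y)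
    (h : ∀ P, IsSharpMeter P → ∃ r, ∀ y, L (P y) = noisyMeter r P y) :
    L = depolarizing d t := by
  obtain ⟨U, hU, hPU⟩ := hP₀.exists_unitary
  have aux (r : ℝ) {P : Fin d → Op (Fin d)} (hP : IsSharpMeter P)
      (hr : ∀ y, L (conjMap U (P y)) = noisyMeter r (fun x => conjMap U (P x)) y) (y : Fin d) :
      rotate U L (P y) = depolarizing d r (P y) := by
    have hC : IsSharpMeter fun x => conjMap U (P x) := hP.conj hU
    rw [rotate_apply, hr, hC.noisyMeter_eq, ← conjMap_depolarizing hU, conjMap_conjTranspose_apply hU]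
  apply rotate_injective hU
  rw [rotate_depolarizing hU]
  refine eq_depolarizing_of_noisy_single hd (aux t isSharpMeter_single fun y => ?_)
    fun P hP => ?_
  · have : P₀ = fun x => conjMap U (Matrix.single x x 1) := funext hPU
    rw [← this, ← h0, this]
  · obtain ⟨r, hr⟩ := h _ (hP.conj hU : IsSharpMeter fun x => conjMap U (P x))
    refine ⟨r, fun y => ?_⟩
    rw [hP.noisyMeter_eq]
    exact aux r hP hr y

/-- The second marginal of the scheme is the adjoint of the total channel applied to the second
meter, so rigidity applies, with the parameter t read off from P. -/
theorem sequentialTradeoff_subset_regionQI (hd : 1 ≤ d) {Q P : Fin d → Op (Fin d)}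
    (hP : IsSharpMeter P) : sequentialTradeoff Q P ⊆ regionQI Q := by
  rintro ⟨s, t⟩ ⟨hs, ht, J, ⟨hJ, hseq⟩, -, h1, h2⟩
  have hrow (x) (P' : Fin d → Op (Fin d)) (hP' : IsSharpMeter P') :
      ∑ y, sequentialMeter J P' (x, y) = adjointMap (J x) 1 := by
    simp only [sequentialMeter]
    rw [← map_sum, hP'.sum_eq_one]
  have hcol (y) (P' : Fin d → Op (Fin d)) :
      ∑ x, sequentialMeter J P' (x, y) = adjointMap (∑ x, J x) (P' y) := by
    refine (adjointMap_eq_of_trace fun ρ => ?_).symm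
    simp only [sequentialMeter, Finset.mul_sum, Matrix.trace_sum, trace_mul_adjointMap,
      LinearMap.sum_apply, Finset.sum_mul]
  refine ⟨hs, ht, J, hJ, fun x => by rw [← h1, hrow x P hP], ?_⟩
  apply adjointMap_ext
  rw [adjointMap_depolarizing]
  refine eq_depolarizing_of_noisy hd hP (fun y => by rw [← hcol, h2]) fun P' hP' => ?_
  obtain ⟨-, -, r, -, -, -, h4⟩ := hseq P' hP'
  exact ⟨r, fun y => by rw [← hcol, h4]⟩

end Constancy

/-! ### Necessity of the inequality for instruments -/

section Necessity
variable {d : ℕ}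

/-- The elements `⟨i|Φ(|i⟩⟨j|)|j⟩` of a completely positive map form a positive semidefinite
matrix. -/
theorem IsCP.posSemidef_coherences {Φ : Op (Fin d) →ₗ[ℂ] Op (Fin d)} (hΦ : IsCP Φ) :
    (Matrix.of fun i j => Φ (Matrix.single i j 1) i j).PosSemidef := by
  rw [isCP_iff] at hΦ
  -- The block matrix of matrix units is the projection, up to scale, onto the maximally entangled
  -- vector. Its image is the Choi matrix, of which the rows and columns (i, i) are kept.
  have h := hΦ d (fun i j => Matrix.single i j 1) (by
    have : Matrix.comp (Fin d) (Fin d) (Fin d) (Fin d) ℂ (fun i j => Matrix.single i j 1) =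
        Matrix.vecMulVec (fun p : Fin d × Fin d => (1 : Op (Fin d)) p.1 p.2)
          (star fun p : Fin d × Fin d => (1 : Op (Fin d)) p.1 p.2) := by
      ext ⟨i, a⟩ ⟨j, b⟩
      change Matrix.single i j (1 : ℂ) a b = _
      simp [Matrix.vecMulVec_apply, Matrix.one_apply, Matrix.single_apply, ite_and, apply_ite]
      split_ifs <;> simp_all
    rw [this]
    exact Matrix.posSemidef_vecMulVec_self_star _)
  exact h.submatrix (fun i => (i, i))

/-- Positivity at the vector c e_i - e_j. -/
theorem two_mul_re_le_of_posSemidef {M : Op (Fin d)} (hM : M.PosSemidef) (c : ℝ) (i j : Fin d) :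
    2 * c * (M i j).re ≤ c ^ 2 * (M i i).re + (M j j).re := by
  have h := (Matrix.posSemidef_iff_dotProduct_mulVec.mp hM).2
    (Pi.single i (c : ℂ) - Pi.single j 1)
  have hji : M j i = star (M i j) := (hM.1.apply i j).symm ▸ by simp
  rw [Complex.nonneg_iff] at h
  have h1 := h.1
  simp [Matrix.mulVec_sub, hji] at h1
  nlinarith [h1]

/-- Put A = √(1-t), B = √(1-s). On the boundary curve (1 - A² - B²)d = 2AB, the hypothesis
multiplied by d reads 0 ≤ ((A+B)c - B)², so the sharp choice is c = B/(A+B). -/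
theorem add_le_of_quadratic_bound (hd : 1 ≤ d) {s t : ℝ} (hs : s ∈ Set.Icc (0 : ℝ) 1)
    (ht : t ∈ Set.Icc (0 : ℝ) 1)
    (h : ∀ c ∈ Set.Icc (0 : ℝ) 1, c * t ≤ c ^ 2 * (t + (1 - t) / d) +
      (1 - c) * ((1 - s) / d) * (1 + c * (d - 1))) :
    s + t ≤ 1 + 2 * (√(1 - s) * √(1 - t)) / d := by
  have hd0 : (1 : ℝ) ≤ d := by exact_mod_cast hd
  have hdp : (0 : ℝ) < d := by linarith
  have hA : √(1 - t) ^ 2 = 1 - t := Real.sq_sqrt (by linarith [ht.2])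
  have hB : √(1 - s) ^ 2 = 1 - s := Real.sq_sqrt (by linarith [hs.2])
  have hA0 : 0 ≤ √(1 - t) := Real.sqrt_nonneg _
  have hB0 : 0 ≤ √(1 - s) := Real.sqrt_nonneg _
  generalize √(1 - t) = A at *
  generalize √(1 - s) = B at *
  obtain rfl : t = 1 - A ^ 2 := by linarith
  obtain rfl : s = 1 - B ^ 2 := by linarith
  have h' (c : ℝ) (hc : c ∈ Set.Icc (0 : ℝ) 1) : c * (1 - A ^ 2) * d ≤
      c ^ 2 * (d - A ^ 2 * (d - 1)) + (1 - c) * B ^ 2 * (1 + c * (d - 1)) := by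
    have := mul_le_mul_of_nonneg_right (h c hc) hdp.le
    have e : (c ^ 2 * (1 - A ^ 2 + (1 - (1 - A ^ 2)) / d) +
        (1 - c) * ((1 - (1 - B ^ 2)) / d) * (1 + c * (d - 1))) * d =
        c ^ 2 * (d - A ^ 2 * (d - 1)) + (1 - c) * B ^ 2 * (1 + c * (d - 1)) := by
      field_simp
      ring
    rwa [e] at this
  rcases hA0.eq_or_lt with h0 | hApos
  · subst h0
    by_contra! hlt
    have hB1 : B ^ 2 < 1 := by
      rw [mul_zero, mul_zero, zero_div] at hlt
      linarith
    -- For A = 0 the sharp choice is c = 1, where the bound is a trivial equality; a value strictly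
    -- below 1 is needed. Likewise, for B = 0 the sharp choice c = 0 is replaced by a positive
    -- value.
    have := h' ((1 + B ^ 2) / 2) ⟨by positivity, by linarith⟩
    have h2 : 0 < (1 - B ^ 2) ^ 2 * (d * (1 + B ^ 2) - B ^ 2) := by
      have : 0 < 1 - B ^ 2 := by linarith
      have : 0 < d * (1 + B ^ 2) - B ^ 2 := by nlinarith [sq_nonneg B]
      positivity
    nlinarith
  rcases hB0.eq_or_lt with h0 | hBpos
  · subst h0
    by_contra! hlt
    have hA1 : A ^ 2 < 1 := by
      rw [zero_mul, mul_zero, zero_div] at hlt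
      linarith
    have := h' ((1 - A ^ 2) / 2) ⟨by linarith, by linarith [sq_nonneg A]⟩
    have h2 : 0 < (1 - A ^ 2) ^ 2 := by
      have : 0 < 1 - A ^ 2 := by linarith
      positivity
    nlinarith [mul_nonneg h2.le (mul_nonneg (sq_nonneg A) (sub_nonneg.mpr hd0)),
      mul_pos h2 hdp]
  · have hAB : 0 < A + B := by linarith
    have h1 := mul_le_mul_of_nonneg_right (h' (B / (A + B)) ⟨by positivity, by
      rw [div_le_one hAB]; linarith⟩) (sq_nonneg (A + B))
    have e : ((B / (A + B)) ^ 2 * (d - A ^ 2 * (d - 1)) +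
        (1 - B / (A + B)) * B ^ 2 * (1 + B / (A + B) * (d - 1))) * (A + B) ^ 2 =
        B ^ 2 * (d - A ^ 2 * (d - 1)) + A * B ^ 2 * (A + B + B * (d - 1)) := by
      field_simp
      ring
    have e' : B / (A + B) * (1 - A ^ 2) * d * (A + B) ^ 2 = B * (A + B) * (1 - A ^ 2) * d := by
      field_simp
    rw [e, e'] at h1
    have h2 : A * B * ((1 - A ^ 2 - B ^ 2) * d) ≤ A * B * (2 * (B * A)) := by nlinarith
    have h3 := le_of_mul_le_mul_left h2 (by positivity)
    rw [← le_div_iff₀ hdp] at h3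
    linarith

/-- Each outcome x gives a positive matrix m_x of preserved coherences. The total off-diagonal
coherence must be t, yet accuracy of the meter makes m_x(i, i) small for x ≠ i. Two basis vectors i,
j suffice to play these off against each other. -/
theorem add_le_of_isJointInstrument_single (hd : 2 ≤ d) {s t : ℝ} (hs : s ∈ Set.Icc (0 : ℝ) 1)
    (ht : t ∈ Set.Icc (0 : ℝ) 1) {J : Fin d → Op (Fin d) →ₗ[ℂ] Op (Fin d)}
    (hJ : ∀ x, IsCP (J x))
    (hM : ∀ x, adjointMap (J x) 1 = depolarizing d s (Matrix.single x x 1))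
    (hsum : ∑ x, J x = depolarizing d t) :
    s + t ≤ 1 + 2 * (√(1 - s) * √(1 - t)) / d := by
  set m : Fin d → Op (Fin d) := fun x => Matrix.of fun i j => J x (Matrix.single i j 1) i j
    with hm
  have hpos (x) : (m x).PosSemidef := (hJ x).posSemidef_coherences
  have hmsum (i j) : ∑ x, (m x i j).re = (depolarizing d t (Matrix.single i j 1) i j).re := by
    rw [← hsum, LinearMap.sum_apply, Matrix.sum_apply, Complex.re_sum]
    rfl
  have hdiag (i) : ∑ x, (m x i i).re = t + (1 - t) / d := by
    rw [hmsum, depolarizing_apply]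
    simp
  have hoff (i j) (hij : i ≠ j) : ∑ x, (m x i j).re = t := by
    rw [hmsum, depolarizing_apply]
    simp [hij]
  have hsmall (x i) (hxi : x ≠ i) : (m x i i).re ≤ (1 - s) / d := by
    have h1 : (J x (Matrix.single i i 1)).trace = ((1 - s) / d : ℝ) := by
      have h2 := congrFun (congrFun (hM x) i) i
      rw [depolarizing_apply] at h2
      simpa [adjointMap, hxi] using h2
    have h2 := (hJ x).posSemidef_map (isSharpMeter_single.posSemidef i)
    have h3 := congrArg Complex.re h1
    rw [Complex.ofReal_re, Matrix.trace, Complex.re_sum] at h3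
    rw [← h3]
    exact Finset.single_le_sum (f := fun k => (J x (Matrix.single i i 1) k k).re)
      (fun k _ => (Complex.nonneg_iff.mp h2.diag_nonneg).1) (Finset.mem_univ i)
  apply add_le_of_quadratic_bound (by omega) hs ht
  intro c hc
  set i : Fin d := ⟨0, by omega⟩
  set j : Fin d := ⟨1, by omega⟩
  have hij : i ≠ j := by simp [i, j]
  have hlow (i : Fin d) : t + (1 - t) / d - (d - 1) * ((1 - s) / d) ≤ (m i i i).re := by
    have h1 : ∑ x, (m x i i).re ≤
        ∑ x, ((1 - s) / d + if x = i then (m i i i).re - (1 - s) / d else 0) := by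
      refine Finset.sum_le_sum fun x _ => ?_
      split_ifs with hx
      · subst hx; linarith
      · linarith [hsmall x i hx]
    rw [hdiag, Finset.sum_add_distrib, Finset.sum_ite_eq' Finset.univ i, Finset.sum_const,
      Finset.card_univ, Fintype.card_fin, if_pos (Finset.mem_univ _), nsmul_eq_mul] at h1
    linarith
  -- The test vector depends on the outcome: weight c goes on the large diagonal entry when x is i
  -- or j, and equal weights are used otherwise. The conditional terms correct the balanced bound at
  -- these two outcomes.
  have hmain : ∑ x, 2 * c * (m x i j).re ≤ ∑ x, (c * (m x i i).re + c * (m x j j).re +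
      (if x = i then (c ^ 2 - c) * (m i i i).re + (1 - c) * (m i j j).re else 0) +
      (if x = j then (c ^ 2 - c) * (m j j j).re + (1 - c) * (m j i i).re else 0)) := by
    refine Finset.sum_le_sum fun x _ => ?_
    by_cases hxi : x = i
    · subst hxi
      rw [if_pos rfl, if_neg hij]
      linarith [two_mul_re_le_of_posSemidef (hpos i) c i j]
    by_cases hxj : x = j
    · subst hxj
      rw [if_pos rfl, if_neg hxi]
      have h1 := two_mul_re_le_of_posSemidef (hpos j) c j i
      rw [← (hpos j).1.apply] at h1
      simp only [Complex.star_def, Complex.conj_re] at h1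
      linarith
    · rw [if_neg hxi, if_neg hxj]
      have h1 := two_mul_re_le_of_posSemidef (hpos x) 1 i j
      nlinarith [hc.1]
  simp only [Finset.sum_add_distrib, ← Finset.mul_sum, Finset.sum_ite_eq', Finset.mem_univ,
    if_true, hdiag, hoff i j hij] at hmain
  have hcc : 0 ≤ c - c ^ 2 := by nlinarith [hc.1, hc.2]
  have hc1 : 0 ≤ 1 - c := by linarith [hc.2]
  have a1 := mul_le_mul_of_nonneg_left (hlow i) hcc
  have a2 := mul_le_mul_of_nonneg_left (hlow j) hcc
  have a3 := mul_le_mul_of_nonneg_left (hsmall i j hij) hc1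
  have a4 := mul_le_mul_of_nonneg_left (hsmall j i hij.symm) hc1
  nlinarith

theorem add_le_of_mem_regionQI (hd : 2 ≤ d) {Q : Fin d → Op (Fin d)} (hQ : IsSharpMeter Q)
    {s t : ℝ} (h : (s, t) ∈ regionQI Q) : s + t ≤ 1 + 2 * (√(1 - s) * √(1 - t)) / d := by
  obtain ⟨hs, ht, J, hJ, hM, hsum⟩ := h
  obtain ⟨U, hU, hQU⟩ := hQ.exists_unitary
  refine add_le_of_isJointInstrument_single hd hs ht (J := fun x => rotate U (J x))
    (fun x => (isCP_conjMap _).comp ((hJ.1 x).comp (isCP_conjMap _))) (fun x => ?_) ?_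
  · have h1 : conjMap U 1 = 1 := by rw [conjMap_apply, Matrix.mul_one, mul_eq_one_comm.mp hU]
    rw [adjointMap_rotate, rotate_apply, h1, hM, hQ.noisyMeter_eq, hQU, ← conjMap_apply,
      ← conjMap_depolarizing hU, conjMap_conjTranspose_apply hU]
  · rw [← rotate_depolarizing hU, ← hsum]
    ext1 A
    simp [LinearMap.sum_apply, rotate_apply]

end Necessity

/-! ### Closing the circle of inclusions -/

theorem regionQI_subset_regionII {d : ℕ} (hd : 1 ≤ d) {Q : Fin d → Op (Fin d)}
    (hQ : IsSharpMeter Q) : regionQI Q ⊆ regionII d := by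
  rintro ⟨s, t⟩ h
  rcases hd.eq_or_lt with rfl | hd2
  · exact mem_regionII_one h.1 h.2.1
  · exact mem_regionII_of_le hd h.1 h.2.1 (add_le_of_mem_regionQI hd2 hQ h)

end Qudit

theorem mainTheorem3 (d : ℕ) (hd : 1 ≤ d) (Q : Fin d → Qudit.Op (Fin d))
    (hQ : Qudit.IsSharpMeter Q) :
    Qudit.regionQI Q = Qudit.regionII d ∧
    ∀ P : Fin d → Qudit.Op (Fin d), Qudit.IsSharpMeter P →
      Qudit.cloningTradeoff Q P = Qudit.sequentialTradeoff Q P ∧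
      Qudit.cloningTradeoff Q P = Qudit.regionII d := by
  have hQI := Qudit.regionQI_subset_regionII hd hQ
  refine ⟨hQI.antisymm (Qudit.regionII_subset_regionQI hd hQ), fun P hP => ?_⟩
  have h1 := Qudit.regionII_subset_cloningTradeoff hd hQ hP
  have h2 := Qudit.cloningTradeoff_subset_sequentialTradeoff (P := P) hQ
  have h3 := (Qudit.sequentialTradeoff_subset_regionQI hd hP).trans hQI
  exact ⟨h2.antisymm (h3.trans h1), (h2.trans h3).antisymm h1⟩
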